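/- Let $\mathcal X$ be a metric space with its Borel $\sigma$-algebra, let $h\ge 0$ be an integer, and let $\{f_\phi:\mathcal X\to\mathbb R^h\}_{\phi\in\Phi}$ be a family of injective functions. For probability measures $\mathbb P,\mathbb Q$ on $\mathcal X$ let $$M_{f_\phi}(\mathbb P,\mathbb Q)=\mathbb E_{x,x'\sim\mathbb P}[k_\phi(x,x')]-2\,\mathbb E_{x\sim\mathbb P,\,y\sim\mathbb Q}[k_\phi(x,y)]+\mathbb E_{y,y'\sim\mathbb Q}[k_\phi(y,y')],\qquad k_\phi(x,x')=\exp\!\big(-\|f_\phi(x)-f_\phi(x')\|^2\big),$$ where all draws are independent and $\|\cdot\|$ is the Euclidean norm, be the squared maximum mean discrepancy for the Gaussian kernel composed with $f_\phi$. Assume that (i) the $f_\phi$ are locally Lipschitz with local constants independent of $\phi$: every $x\in\mathcal X$ has a neighbourhood $U$ and a constant $L$ such that $\|f_\phi(y)-f_\phi(y')\|\le L\,d(y,y')$ for all $y,y'\in U$ and all $\phi\in\Phi$; (ii) for at least one $\phi\in\Phi$ the map $f_\phi$ is a homeomorphism onto its image. (If $\mathcal X$ is compact and $\Phi\neq\emptyset$,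 this follows from injectivity and (i).) Then for every probability measure $\mathbb P_{\mathcal X}$ and every sequence $(\mathbb P_n)$ of probability measures on $\mathcal X$, $$\sup_{\phi\in\Phi} M_{f_\phi}(\mathbb P_{\mathcal X},\mathbb P_n)\xrightarrow[n\to\infty]{}0\iff \mathbb P_n\xrightarrow{\;D\;}\mathbb P_{\mathcal X},$$ where $\xrightarrow{D}$ denotes convergence in distribution (weak convergence of probability measures). -/

import Mathlib

open MeasureTheory Filter Topology

/-- The (squared) maximum mean discrepancy
`E_P[k(x,x')] - 2 E_{P,Q}[k(x,y)] + E_Q[k(y,y')]`, all draws being independent. -/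
noncomputable def mmd {X : Type*} [MeasurableSpace X] (k : X → X → ℝ)
    (P Q : ProbabilityMeasure X) : ℝ :=
  (∫ z, k z.1 z.2 ∂((P : Measure X).prod (P : Measure X)))
    - 2 * (∫ z, k z.1 z.2 ∂((P : Measure X).prod (Q : Measure X)))
    + ∫ z, k z.1 z.2 ∂((Q : Measure X).prod (Q : Measure X))

/-- The Gaussian kernel `exp (-‖u - v‖²)` on `ℝ^h` with the Euclidean norm. -/
noncomputable def gaussianKernel {h : ℕ} (u v : EuclideanSpace ℝ (Fin h)) : ℝ :=
  Real.exp (-‖u - v‖ ^ 2)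

/-- `M_f(P, Q)`: the discrepancy for the composition of the Gaussian kernel with `f`. -/
noncomputable def mmdGaussianComp {X : Type*} [MeasurableSpace X] {h : ℕ}
    (f : X → EuclideanSpace ℝ (Fin h)) (P Q : ProbabilityMeasure X) : ℝ :=
  mmd (fun x x' => gaussianKernel (f x) (f x')) P Q

/-- Every point has a neighbourhood on which all the `f φ` are Lipschitz with one and the same
constant, independent of `φ`. -/
def UniformlyLocallyLipschitz {X Y Φ : Type*} [PseudoEMetricSpace X] [PseudoEMetricSpace Y]
    (f : Φ → X → Y) : Prop :=
  ∀ x : X, ∃ L : NNReal, ∃ U ∈ 𝓝 x, ∀ φ : Φ, LipschitzOnWith L (f φ) U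

open ProbabilityTheory ComplexConjugate RealInnerProductSpace

/-! The Gaussian kernel is the Fourier transform of a Gaussian law of full support, so its
discrepancy is the squared `L²` distance of characteristic functions under that law
(`mmd_gaussianKernel_eq`) and separates probability measures.

Discrepancy to weak convergence: the supremum dominates the term of an embedding `f φ₀`, so it
suffices to work on `ℝ^h` and pull back. There, vanishing discrepancy forces convergence of
integrals of kernel mean embeddings. Embeddings of Lebesgue measure on large balls yield tightness;
Prokhorov gives limit points, which the separation property identifies
(`tendsto_of_tendsto_mmd_gaussianKernel`).

Weak convergence to discrepancy: the discrepancy is the difference of the integrals of a witness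
function, bounded and 2-Lipschitz on `ℝ^h`. Composed with the `f φ`, the witnesses form an
equicontinuous, uniformly bounded family, over which weak convergence is uniform
(`tendsto_integral_uniform_of_equicontinuous`). -/

/-! ### Spectral measure of the Gaussian kernel -/

lemma isOpenPosMeasure_stdGaussian {ι : Type*} [Fintype ι] :
    (stdGaussian (EuclideanSpace ℝ ι)).IsOpenPosMeasure := by
  have : (gaussianReal 0 1).IsOpenPosMeasure :=
    (gaussianReal_absolutelyContinuous' 0 one_ne_zero).isOpenPosMeasure
  rw [← map_pi_eq_stdGaussian]
  exact (PiLp.continuous_toLp 2 _).isOpenPosMeasure_map (WithLp.toLp_surjective 2)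

/-- The law whose characteristic function is the Gaussian `exp (-‖t‖²)`. -/
noncomputable def gaussianSpectralMeasure (h : ℕ) : Measure (EuclideanSpace ℝ (Fin h)) :=
  (stdGaussian (EuclideanSpace ℝ (Fin h))).map (√2 • ·)

instance (h : ℕ) : IsProbabilityMeasure (gaussianSpectralMeasure h) :=
  Measure.isProbabilityMeasure_map (Measurable.aemeasurable (by fun_prop))

instance (h : ℕ) : (gaussianSpectralMeasure h).IsOpenPosMeasure := by
  have := isOpenPosMeasure_stdGaussian (ι := Fin h)
  refine (continuous_const_smul (√2)).isOpenPosMeasure_map fun y => ⟨(√2)⁻¹ • y, ?_⟩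
  simp

lemma charFun_gaussianSpectralMeasure {h : ℕ} (t : EuclideanSpace ℝ (Fin h)) :
    charFun (gaussianSpectralMeasure h) t = Real.exp (-‖t‖ ^ 2) := by
  rw [gaussianSpectralMeasure, charFun_map_smul, charFun_stdGaussian, norm_smul]
  simp only [Complex.ofReal_exp]
  congr 1
  rw [Real.norm_of_nonneg (Real.sqrt_nonneg 2), ← Complex.ofReal_pow, mul_pow,
    Real.sq_sqrt (by norm_num)]
  push_cast
  ring

/-! ### Discrepancy as a distance of characteristic functions -/

section

variable {h : ℕ}

local notation "E" => EuclideanSpace ℝ (Fin h)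

lemma continuous_gaussianKernel : Continuous fun z : E × E => gaussianKernel z.1 z.2 := by
  unfold gaussianKernel
  fun_prop

lemma gaussianKernel_nonneg (u v : E) : 0 ≤ gaussianKernel u v := (Real.exp_pos _).le

lemma gaussianKernel_le_one (u v : E) : gaussianKernel u v ≤ 1 := by
  rw [gaussianKernel, Real.exp_le_one_iff]
  simp

lemma gaussianKernel_comm (u v : E) : gaussianKernel u v = gaussianKernel v u := by
  rw [gaussianKernel, gaussianKernel, norm_sub_rev]

lemma norm_gaussianKernel_le_one (u v : E) : ‖gaussianKernel u v‖ ≤ 1 := by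
  rw [Real.norm_of_nonneg (gaussianKernel_nonneg u v)]
  exact gaussianKernel_le_one u v

lemma integrable_gaussianKernel (μ : Measure (E × E)) [IsFiniteMeasure μ] :
    Integrable (fun z : E × E => gaussianKernel z.1 z.2) μ :=
  Integrable.of_bound continuous_gaussianKernel.aestronglyMeasurable 1
    (ae_of_all _ fun _ => norm_gaussianKernel_le_one _ _)

lemma integrable_charFun_mul_conj_charFun (μ ν : Measure E) [IsFiniteMeasure μ]
    [IsFiniteMeasure ν] :
    Integrable (fun w => charFun μ w * conj (charFun ν w)) (gaussianSpectralMeasure h) := by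
  refine Integrable.of_bound (C := μ.real Set.univ * ν.real Set.univ) ?_ (ae_of_all _ fun w => ?_)
  · exact (measurable_charFun.mul
      (Complex.continuous_conj.measurable.comp measurable_charFun)).aestronglyMeasurable
  · rw [norm_mul, RCLike.norm_conj]
    exact mul_le_mul (norm_charFun_le w) (norm_charFun_le w) (norm_nonneg _) (by positivity)

/-- Spectral representation of the Gaussian kernel, integrated against two finite measures. -/
lemma integral_gaussianKernel_prod (μ ν : Measure E) [IsFiniteMeasure μ] [IsFiniteMeasure ν] :
    ((∫ z, gaussianKernel z.1 z.2 ∂(μ.prod ν) : ℝ) : ℂ) =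
      ∫ w, charFun μ w * conj (charFun ν w) ∂(gaussianSpectralMeasure h) := by
  have hk (z : E × E) : ((gaussianKernel z.1 z.2 : ℝ) : ℂ) =
      ∫ w, Complex.exp (⟪z.1, w⟫ * Complex.I) * Complex.exp (⟪-z.2, w⟫ * Complex.I)
        ∂(gaussianSpectralMeasure h) := by
    rw [gaussianKernel, ← charFun_gaussianSpectralMeasure, charFun_apply]
    congr with w
    rw [← Complex.exp_add, real_inner_comm, inner_sub_left, inner_neg_left]
    push_cast
    ring_nf
  have hc (w : E) : conj (charFun ν w) = ∫ y, Complex.exp (⟪-y, w⟫ * Complex.I) ∂ν := by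
    rw [← charFun_neg, charFun_apply]
    simp
  rw [← integral_complex_ofReal]
  simp_rw [hk]
  rw [integral_integral_swap]
  · congr with w
    rw [hc, charFun_apply]
    exact integral_prod_mul (fun x : E => Complex.exp (⟪x, w⟫ * Complex.I))
      (fun y : E => Complex.exp (⟪-y, w⟫ * Complex.I))
  · refine Integrable.of_bound (C := 1) ?_ (ae_of_all _ fun p => ?_)
    · refine Continuous.aestronglyMeasurable ?_
      simp only [Function.uncurry_def]
      fun_prop
    · simp [Function.uncurry_def, Complex.norm_exp_ofReal_mul_I, -inner_neg_left]

lemma integrable_norm_charFun_sub_sq (μ ν : Measure E) [IsFiniteMeasure μ] [IsFiniteMeasure ν] :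
    Integrable (fun w => ‖charFun μ w - charFun ν w‖ ^ 2) (gaussianSpectralMeasure h) := by
  refine Integrable.of_bound (C := (μ.real Set.univ + ν.real Set.univ) ^ 2) ?_
    (ae_of_all _ fun w => ?_)
  · exact ((measurable_charFun.sub measurable_charFun).norm.pow_const 2).aestronglyMeasurable
  · rw [norm_pow, norm_norm]
    gcongr
    exact (norm_sub_le _ _).trans (add_le_add (norm_charFun_le w) (norm_charFun_le w))

/-- The discrepancy of the Gaussian kernel is a weighted `L²` distance of characteristic
functions. -/
lemma mmd_gaussianKernel_eq (P Q : ProbabilityMeasure E) :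
    mmd gaussianKernel P Q =
      ∫ w, ‖charFun (P : Measure E) w - charFun (Q : Measure E) w‖ ^ 2
        ∂(gaussianSpectralMeasure h) := by
  have key (μ ν : Measure E) [IsFiniteMeasure μ] [IsFiniteMeasure ν] :
      ∫ z, gaussianKernel z.1 z.2 ∂(μ.prod ν) =
        ∫ w, (charFun μ w * conj (charFun ν w)).re ∂(gaussianSpectralMeasure h) := by
    have h1 := integral_re (integrable_charFun_mul_conj_charFun μ ν)
    rw [← integral_gaussianKernel_prod] at h1
    simpa using h1.symm
  have hint (μ ν : Measure E) [IsFiniteMeasure μ] [IsFiniteMeasure ν] :=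
    (integrable_charFun_mul_conj_charFun μ ν).re
  simp only [RCLike.re_to_complex] at hint
  have hsub := (hint (P : Measure E) (P : Measure E)).sub ((hint (P : Measure E) Q).const_mul 2)
  rw [mmd, key, key, key, ← integral_const_mul, ← integral_sub (hint _ _) ((hint _ _).const_mul 2)]
  refine (integral_add hsub (hint (Q : Measure E) Q)).symm.trans ?_
  congr with w
  rw [← Complex.normSq_eq_norm_sq, Complex.normSq_apply]
  simp
  ring

lemma mmd_gaussianKernel_nonneg (P Q : ProbabilityMeasure E) : 0 ≤ mmd gaussianKernel P Q := by
  rw [mmd_gaussianKernel_eq]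
  positivity

/-- The characteristic functions agree almost everywhere for a measure of full support, hence
everywhere by continuity. -/
lemma eq_of_mmd_gaussianKernel_eq_zero {P Q : ProbabilityMeasure E}
    (hPQ : mmd gaussianKernel P Q = 0) : P = Q := by
  rw [mmd_gaussianKernel_eq, integral_eq_zero_iff_of_nonneg (fun _ => by positivity)
    (integrable_norm_charFun_sub_sq (P : Measure E) (Q : Measure E))] at hPQ
  have hc : Continuous fun w : E =>
      ‖charFun (P : Measure E) w - charFun (Q : Measure E) w‖ ^ 2 := by fun_prop
  have h0 := (hc.ae_eq_iff_eq _ continuous_zero).1 hPQ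
  have hmeas : (P : Measure E) = Q := by
    refine Measure.ext_of_charFun (funext fun w => ?_)
    have := congrFun h0 w
    simpa [sub_eq_zero] using this
  exact Subtype.ext hmeas

/-- Differences of kernel mean embeddings are controlled by the discrepancy. -/
lemma abs_integral_gaussianKernel_sub_le (P Q : ProbabilityMeasure E) (ν : Measure E)
    [IsFiniteMeasure ν] :
    |∫ z, gaussianKernel z.1 z.2 ∂((P : Measure E).prod ν) -
        ∫ z, gaussianKernel z.1 z.2 ∂((Q : Measure E).prod ν)| ≤
      √(mmd gaussianKernel P Q) * ν.real Set.univ := by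
  set d : E → ℝ := fun w => ‖charFun (P : Measure E) w - charFun (Q : Measure E) w‖ with hd
  have hdm : AEStronglyMeasurable d (gaussianSpectralMeasure h) :=
    (measurable_charFun.sub measurable_charFun).norm.aestronglyMeasurable
  have hd2 : MemLp d 2 (gaussianSpectralMeasure h) :=
    (memLp_two_iff_integrable_sq hdm).2 (integrable_norm_charFun_sub_sq _ _)
  have hd1 : Integrable d (gaussianSpectralMeasure h) := hd2.integrable (by norm_num)
  have hjensen : ∫ w, d w ∂(gaussianSpectralMeasure h) ≤ √(mmd gaussianKernel P Q) := by
    refine Real.le_sqrt_of_sq_le ?_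
    rw [mmd_gaussianKernel_eq]
    -- Jensen's inequality `(∫ d)² ≤ ∫ d²`, read off from the variance.
    have := variance_nonneg d (gaussianSpectralMeasure h)
    rw [variance_eq_sub hd2] at this
    simpa using this
  rw [← Real.norm_eq_abs, ← Complex.norm_real, Complex.ofReal_sub, integral_gaussianKernel_prod,
    integral_gaussianKernel_prod, ← integral_sub (integrable_charFun_mul_conj_charFun _ _)
      (integrable_charFun_mul_conj_charFun _ _)]
  calc _ ≤ ∫ w, d w * ν.real Set.univ ∂(gaussianSpectralMeasure h) := by
        refine norm_integral_le_of_norm_le (hd1.mul_const _) (ae_of_all _ fun w => ?_)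
        rw [← sub_mul, norm_mul, RCLike.norm_conj]
        exact mul_le_mul_of_nonneg_left (norm_charFun_le w) (norm_nonneg _)
    _ ≤ _ := by
        rw [integral_mul_const]
        gcongr

/-! ### Kernel mean embeddings -/

/-- The kernel mean embedding `v ↦ ∫ k(v, y) dν(y)` of `ν` for the Gaussian kernel. -/
noncomputable def gaussianMean (ν : Measure E) (v : E) : ℝ :=
  ∫ y, gaussianKernel v y ∂ν

lemma continuous_gaussianKernel_right (v : E) : Continuous (gaussianKernel v) := by
  unfold gaussianKernel
  fun_prop

lemma integrable_gaussianKernel_right (ν : Measure E) [IsFiniteMeasure ν] (v : E) :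
    Integrable (gaussianKernel v) ν :=
  Integrable.of_bound (continuous_gaussianKernel_right v).aestronglyMeasurable 1
    (ae_of_all _ fun _ => norm_gaussianKernel_le_one _ _)

lemma gaussianMean_nonneg (ν : Measure E) (v : E) : 0 ≤ gaussianMean ν v :=
  integral_nonneg fun _ => gaussianKernel_nonneg _ _

lemma gaussianMean_le (ν : Measure E) [IsFiniteMeasure ν] (v : E) :
    gaussianMean ν v ≤ ν.real Set.univ := by
  calc gaussianMean ν v ≤ ∫ _, (1 : ℝ) ∂ν :=
        integral_mono (integrable_gaussianKernel_right ν v) (integrable_const _)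
          fun _ => gaussianKernel_le_one _ _
    _ = ν.real Set.univ := by simp

lemma abs_gaussianMean_le (ν : Measure E) [IsFiniteMeasure ν] (v : E) :
    |gaussianMean ν v| ≤ ν.real Set.univ := by
  rw [abs_of_nonneg (gaussianMean_nonneg ν v)]
  exact gaussianMean_le ν v

lemma abs_exp_neg_sq_sub_le (a b : ℝ) :
    |Real.exp (-a ^ 2) - Real.exp (-b ^ 2)| ≤ |a - b| := by
  have hd (x : ℝ) : HasDerivAt (fun x : ℝ => Real.exp (-x ^ 2))
      (Real.exp (-x ^ 2) * (-(2 * x))) x := by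
    have := ((hasDerivAt_pow 2 x).neg).exp
    simpa using this
  have hb (x : ℝ) : ‖Real.exp (-x ^ 2) * (-(2 * x))‖ ≤ 1 := by
    rw [norm_mul, norm_neg, Real.norm_of_nonneg (Real.exp_pos _).le, Real.exp_neg,
      inv_mul_le_one₀ (Real.exp_pos _), Real.norm_eq_abs, abs_mul, abs_two]
    -- `2|x| ≤ 1 + x² ≤ exp (x²)`.
    have h1 := Real.add_one_le_exp (x ^ 2)
    nlinarith [sq_nonneg (|x| - 1), sq_abs x]
  have := Convex.norm_image_sub_le_of_norm_hasDerivWithin_le (s := Set.univ)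
    (fun x _ => (hd x).hasDerivWithinAt) (fun x _ => hb x) convex_univ
    (Set.mem_univ b) (Set.mem_univ a)
  simpa using this

lemma abs_gaussianKernel_sub_le (u v y : E) :
    |gaussianKernel u y - gaussianKernel v y| ≤ dist u v := by
  refine (abs_exp_neg_sq_sub_le _ _).trans ((abs_norm_sub_norm_le _ _).trans_eq ?_)
  rw [sub_sub_sub_cancel_right, dist_eq_norm]

lemma abs_gaussianMean_sub_le (ν : Measure E) [IsFiniteMeasure ν] (u v : E) :
    |gaussianMean ν u - gaussianMean ν v| ≤ ν.real Set.univ * dist u v := by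
  rw [gaussianMean, gaussianMean, ← integral_sub (integrable_gaussianKernel_right ν u)
    (integrable_gaussianKernel_right ν v), mul_comm]
  exact norm_integral_le_of_norm_le_const (f := fun y => gaussianKernel u y - gaussianKernel v y)
    (ae_of_all _ fun y => abs_gaussianKernel_sub_le u v y)

lemma continuous_gaussianMean (ν : Measure E) [IsFiniteMeasure ν] :
    Continuous (gaussianMean ν) :=
  (LipschitzWith.of_dist_le_mul (K := ⟨ν.real Set.univ, measureReal_nonneg⟩)
    fun u v => abs_gaussianMean_sub_le ν u v).continuous

lemma integrable_gaussianMean (μ ν : Measure E) [IsFiniteMeasure μ] [IsFiniteMeasure ν] :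
    Integrable (gaussianMean ν) μ :=
  Integrable.of_bound (continuous_gaussianMean ν).aestronglyMeasurable _
    (ae_of_all _ (abs_gaussianMean_le ν))

lemma integral_gaussianKernel_prod_eq (μ ν : Measure E) [IsFiniteMeasure μ] [IsFiniteMeasure ν] :
    ∫ z, gaussianKernel z.1 z.2 ∂(μ.prod ν) = ∫ v, gaussianMean ν v ∂μ :=
  integral_prod _ (integrable_gaussianKernel _)

lemma integral_gaussianMean_comm (μ ν : Measure E) [IsFiniteMeasure μ] [IsFiniteMeasure ν] :
    ∫ v, gaussianMean ν v ∂μ = ∫ v, gaussianMean μ v ∂ν := by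
  rw [← integral_gaussianKernel_prod_eq, ← integral_gaussianKernel_prod_eq,
    ← integral_prod_swap]
  simp [gaussianKernel_comm]

/-- The symmetry of the kernel lets the cross term be split in two, which exhibits the witness
function. -/
lemma mmd_gaussianKernel_eq_integral_gaussianMean (P Q : ProbabilityMeasure E) :
    mmd gaussianKernel P Q =
      ∫ v, (gaussianMean P v - gaussianMean Q v) ∂(P : Measure E) -
        ∫ v, (gaussianMean P v - gaussianMean Q v) ∂(Q : Measure E) := by
  rw [mmd, integral_gaussianKernel_prod_eq, integral_gaussianKernel_prod_eq,
    integral_gaussianKernel_prod_eq,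
    integral_sub (integrable_gaussianMean _ _) (integrable_gaussianMean _ _),
    integral_sub (integrable_gaussianMean _ _) (integrable_gaussianMean _ _),
    integral_gaussianMean_comm (Q : Measure E) P]
  ring

lemma mmd_gaussianKernel_le_two (P Q : ProbabilityMeasure E) : mmd gaussianKernel P Q ≤ 2 := by
  have h0 (μ ν : ProbabilityMeasure E) : 0 ≤ ∫ v, gaussianMean ν v ∂(μ : Measure E) :=
    integral_nonneg (gaussianMean_nonneg _)
  have h1 (μ ν : ProbabilityMeasure E) : ∫ v, gaussianMean ν v ∂(μ : Measure E) ≤ 1 := by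
    calc _ ≤ ∫ _, (1 : ℝ) ∂(μ : Measure E) :=
          integral_mono (integrable_gaussianMean _ _) (integrable_const _)
            fun v => (gaussianMean_le _ v).trans_eq (by simp)
      _ = 1 := by simp
  rw [mmd, integral_gaussianKernel_prod_eq, integral_gaussianKernel_prod_eq,
    integral_gaussianKernel_prod_eq]
  linarith [h1 P P, h0 P Q, h1 Q Q]

lemma tendsto_integral_gaussianMean {Q : ℕ → ProbabilityMeasure E} {Q₀ : ProbabilityMeasure E}
    (hQ : Tendsto (fun n => mmd gaussianKernel Q₀ (Q n)) atTop (𝓝 0))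
    (ν : Measure E) [IsFiniteMeasure ν] :
    Tendsto (fun n => ∫ v, gaussianMean ν v ∂(Q n : Measure E)) atTop
      (𝓝 (∫ v, gaussianMean ν v ∂(Q₀ : Measure E))) := by
  rw [tendsto_iff_norm_sub_tendsto_zero]
  refine squeeze_zero (fun _ => norm_nonneg _) (fun n => ?_)
    (by simpa using (hQ.sqrt.mul_const (ν.real Set.univ)))
  rw [norm_sub_rev, ← integral_gaussianKernel_prod_eq, ← integral_gaussianKernel_prod_eq]
  exact abs_integral_gaussianKernel_sub_le _ _ _

/-! ### Tightness and weak convergence on `ℝ^h` -/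

lemma integrable_exp_neg_norm_sq : Integrable (fun v : E => Real.exp (-‖v‖ ^ 2)) := by
  have h1 := GaussianFourier.integrable_cexp_neg_mul_sq_norm_add (V := E) (b := 1) (by simp) 0 0
  have h2 := h1.norm
  refine h2.congr (ae_of_all _ fun v => ?_)
  simp only [Complex.norm_exp]
  congr 1
  simp [← Complex.ofReal_pow]

lemma integral_gaussianKernel_volume (v : E) :
    ∫ y, gaussianKernel v y = ∫ y : E, Real.exp (-‖y‖ ^ 2) :=
  integral_sub_left_eq_self (fun y : E => Real.exp (-‖y‖ ^ 2)) volume v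

lemma integrable_gaussianKernel_volume (v : E) : Integrable (gaussianKernel v) :=
  integrable_exp_neg_norm_sq.comp_sub_left v

/-- Convergence in discrepancy of the Gaussian kernel implies tightness: test against the mean
embeddings of Lebesgue measure on large balls. -/
lemma isTightMeasureSet_of_tendsto_mmd {Q : ℕ → ProbabilityMeasure E} {Q₀ : ProbabilityMeasure E}
    (hQ : Tendsto (fun n => mmd gaussianKernel Q₀ (Q n)) atTop (𝓝 0)) :
    IsTightMeasureSet (Set.range fun n => (Q n : Measure E)) := by
  set c : ℝ := ∫ y : E, Real.exp (-‖y‖ ^ 2) with hc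
  have hc0 : 0 < c := integral_exp_pos integrable_exp_neg_norm_sq
  let ν (m : ℕ) : Measure E := volume.restrict (Metric.closedBall 0 m)
  have hν (m : ℕ) : IsFiniteMeasure (ν m) :=
    isFiniteMeasure_restrict.2 measure_closedBall_lt_top.ne
  have hle (m : ℕ) (v : E) : gaussianMean (ν m) v ≤ c := by
    rw [hc, ← integral_gaussianKernel_volume v]
    exact setIntegral_le_integral (integrable_gaussianKernel_volume v)
      (ae_of_all _ fun _ => gaussianKernel_nonneg _ _)
  have hlim (v : E) : Tendsto (fun m => gaussianMean (ν m) v) atTop (𝓝 c) := by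
    rw [hc, ← integral_gaussianKernel_volume v]
    exact (aecover_closedBall tendsto_natCast_atTop_atTop).integral_tendsto_of_countably_generated
      (integrable_gaussianKernel_volume v)
  have hlimQ : Tendsto (fun m => ∫ v, gaussianMean (ν m) v ∂(Q₀ : Measure E)) atTop (𝓝 c) := by
    have : Tendsto (fun m => ∫ v, gaussianMean (ν m) v ∂(Q₀ : Measure E)) atTop
        (𝓝 (∫ _, c ∂(Q₀ : Measure E))) :=
      tendsto_integral_of_dominated_convergence (fun _ => c)
        (fun m => (continuous_gaussianMean (ν m)).aestronglyMeasurable) (integrable_const _)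
        (fun m => ae_of_all _ fun v => by
          rw [Real.norm_of_nonneg (gaussianMean_nonneg _ _)]
          exact hle m v) (ae_of_all _ hlim)
    simpa using this
  have key (ε : ℝ) (hε : 0 < ε) :
      ∃ R : ℝ, ∀ᶠ n in atTop, (Q n : Measure E).real {x | R < ‖x‖} ≤ ε := by
    obtain ⟨m, hm⟩ := ((tendsto_order.1 hlimQ).1 (c - c * (ε / 2))
      (sub_lt_self _ (by positivity))).exists
    have hdecay : Tendsto (fun ρ : ℝ => (ν m).real Set.univ * Real.exp (-ρ ^ 2)) atTop (𝓝 0) := by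
      have : Tendsto (fun ρ : ℝ => Real.exp (-ρ ^ 2)) atTop (𝓝 0) :=
        Real.tendsto_exp_neg_atTop_nhds_zero.comp (tendsto_pow_atTop two_ne_zero)
      simpa using this.const_mul ((ν m).real Set.univ)
    obtain ⟨ρ, hρ, hρ0⟩ := (((tendsto_order.1 hdecay).2 (c * (ε / 2)) (by positivity)).and
      (eventually_ge_atTop 0)).exists
    refine ⟨m + ρ, ?_⟩
    have hfar (v : E) (hv : m + ρ < ‖v‖) : gaussianMean (ν m) v ≤ c * (ε / 2) := by
      refine le_trans ?_ hρ.le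
      calc gaussianMean (ν m) v ≤ ∫ _, Real.exp (-ρ ^ 2) ∂(ν m) := by
            refine setIntegral_mono_on (integrable_gaussianKernel_right (ν m) v)
              (integrable_const _) Metric.isClosed_closedBall.measurableSet fun y hy => ?_
            rw [mem_closedBall_zero_iff] at hy
            rw [gaussianKernel, Real.exp_le_exp, neg_le_neg_iff]
            gcongr
            linarith [norm_sub_norm_le v y]
        _ = _ := by rw [integral_const, smul_eq_mul]
    filter_upwards [(tendsto_order.1 (tendsto_integral_gaussianMean hQ (ν m))).1 _ hm] with n hn
    set S : Set E := {x | m + ρ < ‖x‖}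
    have hS : MeasurableSet S := measurableSet_lt measurable_const measurable_norm
    -- The integrand is at most `c * (ε / 2)` on `S` and at most `c` elsewhere; compared with the
    -- lower bound `c - c * (ε / 2)` this leaves mass at most `ε` on `S`.
    have hub : ∫ v, gaussianMean (ν m) v ∂(Q n : Measure E) ≤
        c * (ε / 2) + c - (Q n : Measure E).real S * c := by
      calc _ ≤ ∫ v, (c * (ε / 2) + c - S.indicator (fun _ => c) v) ∂(Q n : Measure E) := by
            refine integral_mono (integrable_gaussianMean _ _)
              ((integrable_const _).sub ((integrable_const _).indicator hS)) fun v => ?_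
            by_cases hv : v ∈ S
            · simpa [hv] using hfar v hv
            · simp only [hv, not_false_eq_true, Set.indicator_of_notMem, sub_zero]
              have : 0 ≤ c * (ε / 2) := by positivity
              linarith [hle m v]
        _ = _ := by
            rw [integral_sub (integrable_const _) ((integrable_const _).indicator hS),
              integral_indicator_const _ hS]
            simp
    by_contra! h'
    have := mul_lt_mul_of_pos_right h' hc0
    linarith
  refine isTightMeasureSet_range_of_tendsto_limsup_measure_norm_gt ?_
  rw [ENNReal.tendsto_nhds_zero]
  intro ε hε
  obtain ⟨δ, hδ0, hδ⟩ : ∃ δ : ℝ, 0 < δ ∧ ENNReal.ofReal δ ≤ ε := by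
    obtain ⟨δ, hδ0, hδ⟩ := ENNReal.lt_iff_exists_nnreal_btwn.1 hε
    exact ⟨δ, by exact_mod_cast hδ0, by simpa using hδ.le⟩
  obtain ⟨R, hR⟩ := key δ hδ0
  filter_upwards [eventually_ge_atTop R] with r hr
  refine limsup_le_of_le (by isBoundedDefault) ?_
  filter_upwards [hR] with n hn
  refine le_trans ?_ hδ
  have hsub : {x : E | r < ‖x‖} ⊆ {x | R < ‖x‖} := fun x hx => hr.trans_lt hx
  refine (measure_mono hsub).trans ?_
  rw [← ofReal_measureReal (μ := (Q n : Measure E))]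
  exact ENNReal.ofReal_le_ofReal hn

/-- The discrepancy of the Gaussian kernel controls weak convergence on `ℝ^h`. -/
theorem tendsto_of_tendsto_mmd_gaussianKernel {Q : ℕ → ProbabilityMeasure E}
    {Q₀ : ProbabilityMeasure E}
    (hQ : Tendsto (fun n => mmd gaussianKernel Q₀ (Q n)) atTop (𝓝 0)) :
    Tendsto Q atTop (𝓝 Q₀) := by
  refine (tendsto_iff_ultrafilter _ _ _).2 fun U hU => ?_
  have htight : IsTightMeasureSet {((μ : ProbabilityMeasure E) : Measure E) | μ ∈ Set.range Q} := by
    convert! isTightMeasureSet_of_tendsto_mmd hQ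
    ext
    simp
  obtain ⟨Q', -, hQ' : Tendsto Q U (𝓝 Q')⟩ :=
    (isCompact_closure_of_isTightMeasureSet htight).ultrafilter_le_nhds (U.map Q)
      (.trans (by simp) (monotone_principal subset_closure))
  have hmean (ν : Measure E) [IsFiniteMeasure ν] :
      ∫ v, gaussianMean ν v ∂(Q' : Measure E) = ∫ v, gaussianMean ν v ∂(Q₀ : Measure E) := by
    refine tendsto_nhds_unique ?_ ((tendsto_integral_gaussianMean hQ ν).mono_left hU)
    exact ProbabilityMeasure.tendsto_iff_forall_integral_tendsto.1 hQ'
      (BoundedContinuousFunction.ofNormedAddCommGroup _ (continuous_gaussianMean ν) _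
        (abs_gaussianMean_le ν))
  -- `hmean` with `ν = Q₀` and `ν = Q'` cancels all terms of the discrepancy.
  have : Q₀ = Q' := by
    refine eq_of_mmd_gaussianKernel_eq_zero ?_
    rw [mmd_gaussianKernel_eq_integral_gaussianMean,
      integral_sub (integrable_gaussianMean _ _) (integrable_gaussianMean _ _),
      integral_sub (integrable_gaussianMean _ _) (integrable_gaussianMean _ _), hmean, hmean]
    ring
  rwa [this]

end

/-! ### Uniform convergence over equicontinuous families -/

/-- A countable partition of unity subordinate to given neighbourhoods, in the form of
continuous functions `ψ i` with values in `[0, 1]` whose partial sums increase to one. -/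
lemma exists_seq_subordinate_tsum_one {X : Type*} [PseudoMetricSpace X] [SecondCountableTopology X]
    [Nonempty X] (U : X → Set X) (hU : ∀ x, U x ∈ 𝓝 x) :
    ∃ (c : ℕ → X) (ψ : ℕ → X → ℝ), (∀ i, Continuous (ψ i)) ∧ (∀ i y, 0 ≤ ψ i y) ∧
      (∀ i y, ψ i y ≠ 0 → y ∈ U (c i)) ∧ (∀ N y, ∑ i ∈ Finset.range N, ψ i y ≤ 1) ∧
      ∀ y, ∀ᶠ N in atTop, ∑ i ∈ Finset.range N, ψ i y = 1 := by
  have hr (x : X) : ∃ r > 0, Metric.ball x r ⊆ U x := Metric.mem_nhds_iff.1 (hU x)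
  choose r hr0 hrU using hr
  obtain ⟨s, hs, hsU⟩ := TopologicalSpace.countable_cover_nhds
    fun x => Metric.ball_mem_nhds x (half_pos (hr0 x))
  have hsne : s.Nonempty := by
    by_contra! h
    simp [h] at hsU
    exact (Set.empty_ne_univ hsU)
  obtain ⟨c, rfl⟩ := hs.exists_eq_range hsne
  -- A bump equal to one on the half ball and zero off the ball.
  let b (i : ℕ) (y : X) : ℝ := max 0 (min 1 (2 - 2 * dist y (c i) / r (c i)))
  have hb0 (i y) : 0 ≤ b i y := le_max_left _ _
  have hb1 (i y) : b i y ≤ 1 := max_le zero_le_one (min_le_left _ _)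
  have hbc (i) : Continuous (b i) := by fun_prop
  have hbU (i y) (h : b i y ≠ 0) : y ∈ U (c i) := by
    refine hrU _ (Metric.mem_ball.2 ?_)
    by_contra! h'
    refine h (max_eq_left ((min_le_right _ _).trans ?_))
    have : 1 ≤ dist y (c i) / r (c i) := (one_le_div (hr0 _)).2 h'
    rw [mul_div_assoc]
    linarith
  have hbone (y) : ∃ i, b i y = 1 := by
    have : y ∈ ⋃ x ∈ Set.range c, Metric.ball x (r x / 2) := hsU ▸ Set.mem_univ y
    simp only [Set.mem_range, Set.iUnion_exists, Set.iUnion_iUnion_eq', Set.mem_iUnion,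
      Metric.mem_ball] at this
    obtain ⟨i, hi⟩ := this
    refine ⟨i, ?_⟩
    have h2 : dist y (c i) / r (c i) ≤ 1 / 2 := by
      rw [div_le_iff₀ (hr0 _)]
      linarith
    have : 1 ≤ 2 - 2 * dist y (c i) / r (c i) := by
      rw [mul_div_assoc]
      linarith
    simp only [b]
    rw [min_eq_left this, max_eq_right zero_le_one]
  -- The sum telescopes, and reaches one once some factor `1 - b j y` vanishes.
  have hsum (N y) : ∑ i ∈ Finset.range N, b i y * ∏ j ∈ Finset.range i, (1 - b j y) =
      1 - ∏ j ∈ Finset.range N, (1 - b j y) := by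
    induction N with
    | zero => simp
    | succ N ih =>
      rw [Finset.sum_range_succ, Finset.prod_range_succ, ih]
      ring
  have hprod (N y) : 0 ≤ ∏ j ∈ Finset.range N, (1 - b j y) :=
    Finset.prod_nonneg fun j _ => sub_nonneg.2 (hb1 j y)
  refine ⟨c, fun i y => b i y * ∏ j ∈ Finset.range i, (1 - b j y), fun i => by fun_prop,
    fun i y => mul_nonneg (hb0 i y) (hprod i y), fun i y h => hbU i y (left_ne_zero_of_mul h),
    fun N y => ?_, fun y => ?_⟩
  · rw [hsum]
    linarith [hprod N y]
  · obtain ⟨i, hi⟩ := hbone y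
    filter_upwards [eventually_gt_atTop i] with N hN
    rw [hsum, Finset.prod_eq_zero (Finset.mem_range.2 hN) (by rw [hi, sub_self]), sub_zero]

/-- Along a weakly convergent sequence of probability measures on a separable metric space,
integrals converge uniformly over equicontinuous, uniformly bounded families. -/
theorem tendsto_integral_uniform_of_equicontinuous {X ι : Type*} [PseudoMetricSpace X]
    [SecondCountableTopology X] [MeasurableSpace X] [BorelSpace X] {F : ι → X → ℝ}
    (hF : Equicontinuous F) {C : ℝ} (hC : ∀ i x, |F i x| ≤ C)
    {P : ℕ → ProbabilityMeasure X} {Q : ProbabilityMeasure X} (hP : Tendsto P atTop (𝓝 Q))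
    {ε : ℝ} (hε : 0 < ε) :
    ∀ᶠ n in atTop, ∀ i, |∫ x, F i x ∂(P n : Measure X) - ∫ x, F i x ∂(Q : Measure X)| ≤ ε := by
  have : Nonempty X := nonempty_of_isProbabilityMeasure (Q : Measure X)
  rcases isEmpty_or_nonempty ι with hι | ⟨⟨i₀⟩⟩
  · exact .of_forall fun n i => isEmptyElim i
  have hC0 : 0 ≤ C := (abs_nonneg _).trans (hC i₀ (Classical.arbitrary X))
  -- The total error will be `2 * (δ + C * δ) + C * δ`, below `4 * δ + 4 * (C * δ) = ε`.
  set δ := ε / (4 + 4 * C) with hδ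
  have hδ0 : 0 < δ := by positivity
  have hFδ (x : X) : {y | ∀ i, |F i x - F i y| < δ} ∈ 𝓝 x := by
    have := Metric.equicontinuousAt_iff_right.1 (hF x) δ hδ0
    simp only [Real.dist_eq] at this
    exact this
  obtain ⟨c, ψ, hψc, hψ0, hψU, hψ1, hψe⟩ := exists_seq_subordinate_tsum_one _ hFδ
  have hint (μ : ProbabilityMeasure X) {f : X → ℝ} (hf : Continuous f) {K : ℝ}
      (hK : ∀ x, |f x| ≤ K) : Integrable f (μ : Measure X) :=
    Integrable.of_bound hf.aestronglyMeasurable K (ae_of_all _ hK)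
  have hlim {f : X → ℝ} (hf : Continuous f) {K : ℝ} (hK : ∀ x, |f x| ≤ K) :
      Tendsto (fun n => ∫ x, f x ∂(P n : Measure X)) atTop (𝓝 (∫ x, f x ∂(Q : Measure X))) :=
    ProbabilityMeasure.tendsto_iff_forall_integral_tendsto.1 hP
      (BoundedContinuousFunction.ofNormedAddCommGroup f hf K hK)
  have hψle (i y) : |ψ i y| ≤ 1 := by
    rw [abs_of_nonneg (hψ0 i y)]
    refine le_trans ?_ (hψ1 (i + 1) y)
    exact Finset.single_le_sum (f := fun j => ψ j y) (fun j _ => hψ0 j y)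
      (Finset.mem_range.2 (Nat.lt_succ_self i))
  -- The part missed by the first `N` functions. Its integral is small under `Q` for some `N`, hence
  -- under `P n` eventually, since `R N` is bounded and continuous; this replaces tightness.
  let R (N : ℕ) (y : X) : ℝ := 1 - ∑ i ∈ Finset.range N, ψ i y
  have hR0 (N y) : 0 ≤ R N y := sub_nonneg.2 (hψ1 N y)
  have hR1 (N y) : |R N y| ≤ 1 := by
    rw [abs_of_nonneg (hR0 N y)]
    exact sub_le_self _ (Finset.sum_nonneg fun i _ => hψ0 i y)
  have hRc (N) : Continuous (R N) := by fun_prop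
  obtain ⟨N, hN⟩ : ∃ N, ∫ y, R N y ∂(Q : Measure X) < δ := by
    have : Tendsto (fun N => ∫ y, R N y ∂(Q : Measure X)) atTop
        (𝓝 (∫ _, (0 : ℝ) ∂(Q : Measure X))) := by
      refine tendsto_integral_of_dominated_convergence (fun _ => 1)
        (fun N => (hRc N).aestronglyMeasurable) (integrable_const _)
        (fun N => ae_of_all _ (hR1 N)) (ae_of_all _ fun y => ?_)
      refine tendsto_const_nhds.congr' ?_
      filter_upwards [hψe y] with N hN
      simp [R, hN]
    rw [integral_zero] at this
    exact ((tendsto_order.1 this).2 δ hδ0).exists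
  have hRlim : ∀ᶠ n in atTop, ∫ y, R N y ∂(P n : Measure X) < δ :=
    (tendsto_order.1 (hlim (hRc N) (hR1 N))).2 δ hN
  have hψlim : ∀ᶠ n in atTop, ∑ i ∈ Finset.range N,
      |∫ y, ψ i y ∂(P n : Measure X) - ∫ y, ψ i y ∂(Q : Measure X)| < δ := by
    have : Tendsto (fun n => ∑ i ∈ Finset.range N,
        |∫ y, ψ i y ∂(P n : Measure X) - ∫ y, ψ i y ∂(Q : Measure X)|) atTop
        (𝓝 (∑ i ∈ Finset.range N, 0)) := by
      refine tendsto_finsetSum _ fun i _ => ?_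
      have := ((hlim (hψc i) (hψle i)).sub_const (∫ y, ψ i y ∂(Q : Measure X))).abs
      simpa using this
    rw [Finset.sum_const_zero] at this
    exact (tendsto_order.1 this).2 δ hδ0
  filter_upwards [hRlim, hψlim] with n hRn hψn k
  let H (y : X) : ℝ := ∑ i ∈ Finset.range N, F k (c i) * ψ i y
  have hHi (μ : ProbabilityMeasure X) (i : ℕ) :
      Integrable (fun y => F k (c i) * ψ i y) (μ : Measure X) :=
    (hint μ (hψc i) (hψle i)).const_mul _
  have hH (μ : ProbabilityMeasure X) : ∫ y, H y ∂(μ : Measure X) =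
      ∑ i ∈ Finset.range N, F k (c i) * ∫ y, ψ i y ∂(μ : Measure X) := by
    rw [integral_finsetSum _ fun i _ => hHi μ i]
    simp_rw [integral_const_mul]
  have hpt (y : X) : |F k y - H y| ≤ δ + C * R N y := by
    have h1 : F k y - H y = ∑ i ∈ Finset.range N, (F k y - F k (c i)) * ψ i y + F k y * R N y := by
      simp only [H, R, sub_mul, Finset.sum_sub_distrib, ← Finset.mul_sum, mul_sub]
      ring
    rw [h1]
    refine (abs_add_le _ _).trans (add_le_add ?_ ?_)
    · calc |∑ i ∈ Finset.range N, (F k y - F k (c i)) * ψ i y|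
          ≤ ∑ i ∈ Finset.range N, δ * ψ i y := by
            refine (Finset.abs_sum_le_sum_abs _ _).trans (Finset.sum_le_sum fun i _ => ?_)
            rw [abs_mul, abs_of_nonneg (hψ0 i y)]
            by_cases h0 : ψ i y = 0
            · simp [h0]
            · refine mul_le_mul_of_nonneg_right ?_ (hψ0 i y)
              rw [abs_sub_comm]
              exact (hψU i y h0 k).le
        _ ≤ δ := by
            rw [← Finset.mul_sum]
            exact mul_le_of_le_one_right hδ0.le (hψ1 N y)
    · rw [abs_mul, abs_of_nonneg (hR0 N y)]
      exact mul_le_mul_of_nonneg_right (hC k y) (hR0 N y)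
  have hFH (μ : ProbabilityMeasure X) (hμ : ∫ y, R N y ∂(μ : Measure X) < δ) :
      |∫ y, F k y ∂(μ : Measure X) - ∫ y, H y ∂(μ : Measure X)| ≤ δ + C * δ := by
    rw [← integral_sub (hint μ (hF.continuous k) (hC k))
      (integrable_finsetSum _ fun i _ => hHi μ i)]
    calc |∫ y, (F k y - H y) ∂(μ : Measure X)|
        ≤ ∫ y, (δ + C * R N y) ∂(μ : Measure X) :=
          norm_integral_le_of_norm_le (f := fun y => F k y - H y)
            ((integrable_const δ).add ((hint μ (hRc N) (hR1 N)).const_mul C)) (ae_of_all _ hpt)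
      _ = δ + C * ∫ y, R N y ∂(μ : Measure X) := by
          rw [integral_add (integrable_const δ) ((hint μ (hRc N) (hR1 N)).const_mul C),
            integral_const_mul]
          simp
      _ ≤ δ + C * δ := by gcongr
  have hHH : |∫ y, H y ∂(P n : Measure X) - ∫ y, H y ∂(Q : Measure X)| ≤ C * δ := by
    rw [hH, hH, ← Finset.sum_sub_distrib]
    calc _ ≤ ∑ i ∈ Finset.range N,
          C * |∫ y, ψ i y ∂(P n : Measure X) - ∫ y, ψ i y ∂(Q : Measure X)| := by
          refine (Finset.abs_sum_le_sum_abs _ _).trans (Finset.sum_le_sum fun i _ => ?_)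
          rw [← mul_sub, abs_mul]
          exact mul_le_mul_of_nonneg_right (hC k _) (abs_nonneg _)
      _ ≤ C * δ := by
          rw [← Finset.mul_sum]
          gcongr
  have hε' : ε = 4 * δ + 4 * (C * δ) := by
    rw [hδ]
    field_simp
  have h1 := abs_le.1 (hFH (P n) hRn)
  have h2 := abs_le.1 (hFH Q hN)
  have h3 := abs_le.1 hHH
  have h4 : 0 ≤ C * δ := by positivity
  rw [abs_le]
  constructor <;> linarith [h1.1, h1.2, h2.1, h2.2, h3.1, h3.2]

/-! ### Transfer to the metric space and conclusion -/

/-- Weak convergence can be tested on the images under an embedding. -/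
lemma tendsto_of_tendsto_map_of_isEmbedding {X Y : Type*} [TopologicalSpace X] [MeasurableSpace X]
    [BorelSpace X] [TopologicalSpace Y] [MeasurableSpace Y] [BorelSpace Y] [HasOuterApproxClosed Y]
    {g : X → Y} (hg : IsEmbedding g) {P : ℕ → ProbabilityMeasure X} {Q : ProbabilityMeasure X}
    (h : Tendsto (fun n => (P n).map hg.continuous.measurable.aemeasurable) atTop
      (𝓝 (Q.map hg.continuous.measurable.aemeasurable))) :
    Tendsto P atTop (𝓝 Q) := by
  refine tendsto_of_forall_isOpen_le_liminf_nat' fun U hU => ?_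
  obtain ⟨V, hV, rfl⟩ := hg.isOpen_iff.1 hU
  have := ProbabilityMeasure.le_liminf_measure_open_of_tendsto h hV
  simpa [ProbabilityMeasure.toMeasure_map,
    Measure.map_apply hg.continuous.measurable hV.measurableSet] using this

lemma UniformlyLocallyLipschitz.continuous {X Y Φ : Type*} [PseudoEMetricSpace X]
    [PseudoEMetricSpace Y] {f : Φ → X → Y} (hf : UniformlyLocallyLipschitz f) (φ : Φ) :
    Continuous (f φ) := by
  refine continuous_iff_continuousAt.2 fun x => ?_
  obtain ⟨L, U, hU, hL⟩ := hf x
  exact (hL φ).continuousOn.continuousAt hU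

lemma mmdGaussianComp_eq_mmd_map {X : Type*} [MeasurableSpace X] {h : ℕ}
    {g : X → EuclideanSpace ℝ (Fin h)} (hg : Measurable g) (P Q : ProbabilityMeasure X) :
    mmdGaussianComp g P Q =
      mmd gaussianKernel (P.map hg.aemeasurable) (Q.map hg.aemeasurable) := by
  have key (μ ν : ProbabilityMeasure X) :
      ∫ z, gaussianKernel z.1 z.2 ∂(((μ : Measure X).map g).prod ((ν : Measure X).map g)) =
        ∫ z, gaussianKernel (g z.1) (g z.2) ∂((μ : Measure X).prod (ν : Measure X)) := by
    rw [Measure.map_prod_map _ _ hg hg, integral_map (hg.prodMap hg).aemeasurable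
      continuous_gaussianKernel.aestronglyMeasurable]
    rfl
  rw [mmdGaussianComp, mmd, mmd]
  simp only [ProbabilityMeasure.toMeasure_map, key]

/-- Compositions of uniformly Lipschitz functions with a uniformly locally Lipschitz family form
an equicontinuous family. -/
lemma UniformlyLocallyLipschitz.equicontinuous_comp {X Y Φ ι : Type*} [PseudoMetricSpace X]
    [PseudoMetricSpace Y] {f : Φ → X → Y} (hf : UniformlyLocallyLipschitz f)
    {g : Φ × ι → Y → ℝ} {K : NNReal} (hg : ∀ p, LipschitzWith K (g p)) :
    Equicontinuous fun (p : Φ × ι) x => g p (f p.1 x) := by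
  intro x
  rw [Metric.equicontinuousAt_iff_right]
  intro ε hε
  obtain ⟨L, U, hU, hL⟩ := hf x
  have hlim : Tendsto (fun y => (K * L : ℝ) * dist x y) (𝓝 x) (𝓝 0) := by
    have : Continuous fun y => (K * L : ℝ) * dist x y := by fun_prop
    simpa using this.tendsto x
  filter_upwards [hU, (tendsto_order.1 hlim).2 ε hε] with y hy hyε p
  calc dist (g p (f p.1 x)) (g p (f p.1 y)) ≤ K * dist (f p.1 x) (f p.1 y) := (hg p).dist_le_mul _ _
    _ ≤ K * (L * dist x y) := by
        gcongr
        exact (hL p.1).dist_le_mul _ (mem_of_mem_nhds hU) _ hy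
    _ < ε := by rwa [← mul_assoc]

theorem theorem3 {X : Type*} [MetricSpace X] [MeasurableSpace X] [BorelSpace X]
    {Φ : Type*} {h : ℕ} (f : Φ → X → EuclideanSpace ℝ (Fin h))
    (hinj : ∀ φ, Function.Injective (f φ))
    (hlip : UniformlyLocallyLipschitz f)
    (hemb : ∃ φ, IsEmbedding (f φ))
    (PX : ProbabilityMeasure X) (P : ℕ → ProbabilityMeasure X) :
    Tendsto (fun n => ⨆ φ, mmdGaussianComp (f φ) PX (P n)) atTop (𝓝 0) ↔
      Tendsto P atTop (𝓝 PX) := by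
  have hm (φ : Φ) : Measurable (f φ) := (hlip.continuous φ).measurable
  have hnonneg (φ : Φ) (n : ℕ) : 0 ≤ mmdGaussianComp (f φ) PX (P n) := by
    rw [mmdGaussianComp_eq_mmd_map (hm φ)]
    exact mmd_gaussianKernel_nonneg _ _
  obtain ⟨φ₀, hφ₀⟩ := hemb
  constructor
  · intro hsup
    -- A real `⨆` over an unbounded family is `0`, so boundedness is needed for it to dominate the
    -- term at `φ₀`.
    have hbdd (n : ℕ) : BddAbove (Set.range fun φ => mmdGaussianComp (f φ) PX (P n)) := by
      refine ⟨2, ?_⟩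
      rintro _ ⟨φ, rfl⟩
      simp only [mmdGaussianComp_eq_mmd_map (hm φ)]
      exact mmd_gaussianKernel_le_two _ _
    refine tendsto_of_tendsto_map_of_isEmbedding hφ₀ (tendsto_of_tendsto_mmd_gaussianKernel ?_)
    refine Tendsto.congr (fun n => mmdGaussianComp_eq_mmd_map (hm φ₀) PX (P n)) ?_
    exact squeeze_zero (hnonneg φ₀) (fun n => le_ciSup (hbdd n) φ₀) hsup
  · intro hP
    have : Nonempty Φ := ⟨φ₀⟩
    have : SecondCountableTopology X := hφ₀.secondCountableTopology
    -- The witness depends on `n` as well as `φ`, so uniformity is needed over the pairs.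
    let g (p : Φ × ℕ) (v : EuclideanSpace ℝ (Fin h)) : ℝ :=
      gaussianMean ((PX : Measure X).map (f p.1)) v -
        gaussianMean ((P p.2 : Measure X).map (f p.1)) v
    have hprob (φ : Φ) (μ : ProbabilityMeasure X) :
        IsProbabilityMeasure ((μ : Measure X).map (f φ)) :=
      Measure.isProbabilityMeasure_map (hm φ).aemeasurable
    have hg (p) : LipschitzWith 2 (g p) := by
      refine LipschitzWith.of_dist_le_mul fun u v => ?_
      have h1 := abs_gaussianMean_sub_le ((PX : Measure X).map (f p.1)) u v
      have h2 := abs_gaussianMean_sub_le ((P p.2 : Measure X).map (f p.1)) u v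
      rw [probReal_univ, one_mul, abs_le] at h1 h2
      rw [Real.dist_eq, abs_le, NNReal.coe_ofNat]
      constructor <;> simp only [g] <;> linarith [h1.1, h1.2, h2.1, h2.2]
    have hgb (p : Φ × ℕ) (x : X) : |g p (f p.1 x)| ≤ 2 := by
      have h1 := abs_gaussianMean_le ((PX : Measure X).map (f p.1)) (f p.1 x)
      have h2 := abs_gaussianMean_le ((P p.2 : Measure X).map (f p.1)) (f p.1 x)
      rw [probReal_univ] at h1 h2
      exact (abs_sub _ _).trans (by linarith)
    have hmmd (φ : Φ) (n : ℕ) : mmdGaussianComp (f φ) PX (P n) =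
        ∫ x, g (φ, n) (f φ x) ∂(PX : Measure X) - ∫ x, g (φ, n) (f φ x) ∂(P n : Measure X) := by
      rw [mmdGaussianComp_eq_mmd_map (hm φ), mmd_gaussianKernel_eq_integral_gaussianMean]
      simp only [ProbabilityMeasure.toMeasure_map]
      rw [integral_map (hm φ).aemeasurable (hg (φ, n)).continuous.aestronglyMeasurable,
        integral_map (hm φ).aemeasurable (hg (φ, n)).continuous.aestronglyMeasurable]
    rw [Metric.tendsto_atTop']
    intro ε hε
    obtain ⟨N, hN⟩ := eventually_atTop.1 <| tendsto_integral_uniform_of_equicontinuous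
      (hlip.equicontinuous_comp hg) hgb hP (half_pos hε)
    refine ⟨N, fun n hn => ?_⟩
    rw [Real.dist_eq, sub_zero, abs_of_nonneg (Real.iSup_nonneg fun φ => hnonneg φ n)]
    refine (ciSup_le fun φ => ?_).trans_lt (half_lt_self hε)
    rw [hmmd]
    refine (le_abs_self _).trans ?_
    rw [abs_sub_comm]
    exact hN n hn.le (φ, n)
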